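/- Let $K$ be a field and let $G$ be a finite simple connected bipartite graph with at least one edge and with vertex set $\{v_1,\dots,v_n\}$. Let $g$ be its girth, that is, the length of a shortest cycle of $G$, with $g=\infty$ if $G$ has no cycle. Let $S=K[x_1,\dots,x_n]$ and let $I(G)=(x_ix_j : \{v_i,v_j\}\in E(G))\subseteq S$ be the edge ideal of $G$. Then for every positive integer $k\le g/2+1$ one has $$\operatorname{sdepth}(I(G)^k)\ge 2 .$$ Here sdepth denotes the Stanley depth of a finitely generated $\mathbb Z^n$-graded $S$-module $M$. For a nonzero homogeneous element $u\in M$ and a set $Z\subseteq\{x_1,\dots,x_n\}$, the $K$-subspace $uK[Z]$ of $M$ spanned by all $uw$ with $w$ a monomial in $K[Z]$ is called a Stanley space of dimension $|Z|$ if it is a free $K[Z]$-module. A Stanley decomposition of $M$ is a finite family of Stanley spaces of which $M$ is the direct sum as a $K$-vector space. Its Stanley depth is the smallest dimension of its Stanley spaces, and $\operatorname{sdepth}(M)$ is the largest Stanley depth of a Stanley decomposition of $M$ (with $\operatorname{sdepth}(0)=\infty$). -/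

import Mathlib

open MvPolynomial

/-- The `K`-subspace `u K[Z]` of an `S`-module `M`, `S = K[x_v : v ∈ V]`, spanned by all `w • u`
with `w` a monomial in the variables of `Z`. -/
def stanleySpace (K : Type*) [Field K] {V M : Type*} [AddCommGroup M] [Module K M]
    [Module (MvPolynomial V K) M] (u : M) (Z : Finset V) : Submodule K M :=
  Submodule.span K {m | ∃ d : V →₀ ℕ, d.support ⊆ Z ∧ m = (monomial d (1 : K)) • u}

/-- A Stanley decomposition of a multigraded `S`-module `M` (`S = K[x_v : v ∈ V]`) with graded
components `gr a`, for `a` a vector of integers indexed by `V`: a finite family of Stanley spaces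
`u K[Z]`, with `u` nonzero and homogeneous and `u K[Z]` free as a `K[Z]`-module, of which `M` is
the (internal) direct sum as a `K`-vector space. Here `K[Z]` is the subalgebra
`MvPolynomial.supported K Z` of `S`. -/
structure StanleyDecomposition {K V M : Type*} [Field K] [AddCommGroup M] [Module K M]
    [Module (MvPolynomial V K) M] [IsScalarTower K (MvPolynomial V K) M]
    (gr : (V → ℤ) → Submodule K M) where
  /-- the number of Stanley spaces -/
  len : ℕ
  /-- the generators `u` -/
  gen : Fin len → M
  /-- the sets of variables `Z` -/
  vars : Fin len → Finset V
  gen_ne_zero : ∀ i, gen i ≠ 0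
  homogeneous : ∀ i, ∃ a, gen i ∈ gr a
  free : ∀ i, Module.Free (supported K (vars i : Set V))
    (Submodule.span (supported K (vars i : Set V)) {gen i})
  isInternal : DirectSum.IsInternal fun i => stanleySpace K (gen i) (vars i)

/-- The Stanley depth of a decomposition: the least dimension `|Z|` of its Stanley spaces
(`⊤` for the empty decomposition of the zero module). -/
noncomputable def StanleyDecomposition.depth {K V M : Type*} [Field K] [AddCommGroup M]
    [Module K M] [Module (MvPolynomial V K) M] [IsScalarTower K (MvPolynomial V K) M]
    {gr : (V → ℤ) → Submodule K M} (D : StanleyDecomposition gr) : ℕ∞ :=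
  ⨅ i, ((D.vars i).card : ℕ∞)

/-- The Stanley depth of a multigraded module: the largest Stanley depth of its Stanley
decompositions. It is `⊤` for the zero module. -/
noncomputable def stanleyDepth {K V M : Type*} [Field K] [AddCommGroup M]
    [Module K M] [Module (MvPolynomial V K) M] [IsScalarTower K (MvPolynomial V K) M]
    (gr : (V → ℤ) → Submodule K M) : ℕ∞ :=
  ⨆ D : StanleyDecomposition gr, D.depth

/-- The component of multidegree `a` of an ideal `I` of `K[x_v : v ∈ V]`: the elements of `I` that
are scalar multiples of the monomial with exponent vector `a` (only zero, if `a` has a negative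
entry). For a monomial ideal these form its standard multigrading. -/
def Ideal.multidegreePart {K V : Type*} [Field K] (I : Ideal (MvPolynomial V K)) (a : V → ℤ) :
    Submodule K I where
  carrier := {f | ∀ d ∈ (f : MvPolynomial V K).support, ∀ v, (d v : ℤ) = a v}
  zero_mem' := by simp
  add_mem' := by
    classical
    intro f g hf hg d hd
    rcases Finset.mem_union.1 (MvPolynomial.support_add hd) with h | h
    · exact hf d h
    · exact hg d h
  smul_mem' := by
    intro c f hf d hd
    exact hf d (MvPolynomial.support_smul hd)

/-- The Stanley depth of a (monomial) ideal of `K[x_v : v ∈ V]`, as a multigraded module. -/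
noncomputable def Ideal.sdepth {K V : Type*} [Field K] (I : Ideal (MvPolynomial V K)) : ℕ∞ :=
  stanleyDepth I.multidegreePart

/-- The edge ideal of a graph `G`, generated by the products `x_v x_w` over the edges `vw`. -/
noncomputable def SimpleGraph.edgeIdeal (K : Type*) [Field K] {V : Type*} (G : SimpleGraph V) :
    Ideal (MvPolynomial V K) :=
  Ideal.span {m | ∃ v w, G.Adj v w ∧ m = X v * X w}

/-!
The bound holds for every monomial ideal `I` in at least two variables such that the maximal ideal
`(x_v : v ∈ V)` is not an associated prime of `S / I`; the powers of the edge ideal of a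
bipartite graph with an edge are of this kind.

*From the colon condition to cells.* Write `A` for the set of exponent vectors of `I`, and suppose
that every `u ∉ A` has a variable `z` with `u z ^ t ∉ A` for all `t`. Fix a variable `x` and cut
`A` into the rays in direction `x`. If such a ray starts at `m` with `m x > 0`, then `m / x ∉ A`,
and the `z` given for `m / x` cannot be `x`; multiplying by powers of `z` therefore does not move
the starting height of the ray. So every ray has a second direction `z ≠ x`, called neutral, along
which rays of the same height repeat, and they fill a two-dimensional cell. Taking the
*least* neutral variable makes the choice constant along its own lines
(`IsDirection.add_single`), so that these cells partition `A`. Membership in `A`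
depends only on the truncation of the exponents at some `N`, hence so does the choice; keeping
only cells with corner in the box `[0, N]` and adding to each the variables in which its corner
has exponent `N` gives finitely many cells (`exists_cells`). A finite partition into cells is a
Stanley decomposition (`le_sdepth_of_cells`).

*The colon condition for edge ideals.* For bipartite `G`, König's theorem for the blow-up of `G`
with `d v` copies of each vertex `v` says that `x ^ d` lies in `I(G) ^ k` if and only if each vertex
cover `C` has `∑ v ∈ C, d v ≥ k` (`SimpleGraph.mem_edgeIdeal_pow_iff`). If `u` fails this for `C`,
then so does `u z ^ t` for each vertex `z ∉ C`; such a `z` exists once `C`, if it is all of `V`, is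
replaced by one side of the bipartition.
-/

/-! ### Partitioning an upper set of exponent vectors into cells -/

section Cells

variable {V : Type*} [DecidableEq V]

/-- `m` and `m'` agree after all entries are truncated at `N`. -/
def TruncEq (N : ℕ) (m m' : V → ℕ) : Prop := ∀ v, min (m v) N = min (m' v) N

/-- `z` is neutral at `m` (relative to the fixed variable `x`): adding multiples of `z` to `m` adds
no element to the slice of `A` by the line through `m` in direction `x`. This does not depend on
the entry `m x`. -/
def Neutral (A : Set (V → ℕ)) (x : V) (m : V → ℕ) (z : V) : Prop :=
  ∀ t i, Function.update (m + Pi.single z t) x i ∈ A → Function.update m x i ∈ A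

/-- `z` is the variable other than `x` that is neutral at `m` and has the least rank under `r`.
For injective `r` there is at most one. -/
def IsDirection (A : Set (V → ℕ)) (x : V) (r : V → ℕ) (m : V → ℕ) (z : V) : Prop :=
  (z ≠ x ∧ Neutral A x m z) ∧ ∀ w, w ≠ x → Neutral A x m w → r z ≤ r w

variable {A : Set (V → ℕ)} {x : V} {r : V → ℕ} {N : ℕ}

theorem IsDirection.unique (hr : Function.Injective r) {m : V → ℕ} {z z' : V}
    (h : IsDirection A x r m z) (h' : IsDirection A x r m z') : z = z' :=
  hr (le_antisymm (h.2 _ h'.1.1 h'.1.2) (h'.2 _ h.1.1 h.1.2))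

theorem Neutral.congr (hA : ∀ m m', TruncEq N m m' → m ∈ A → m' ∈ A) {m m' : V → ℕ} {z : V}
    (hm : ∀ v, v ≠ x → min (m v) N = min (m' v) N) (h : Neutral A x m z) :
    Neutral A x m' z := by
  intro t i hi
  refine hA (Function.update m x i) _ ?_ (h t i (hA _ _ ?_ hi))
  · intro v
    by_cases hv : v = x
    · subst hv; simp
    · simpa [hv] using hm v hv
  · intro v
    by_cases hv : v = x
    · subst hv; simp
    · have := hm v hv
      simp only [Function.update_of_ne hv, Pi.add_apply]
      omega

theorem IsDirection.congr (hA : ∀ m m', TruncEq N m m' → m ∈ A → m' ∈ A) {m m' : V → ℕ} {z : V}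
    (hm : ∀ v, v ≠ x → min (m v) N = min (m' v) N) (h : IsDirection A x r m z) :
    IsDirection A x r m' z :=
  ⟨⟨h.1.1, h.1.2.congr hA hm⟩,
    fun w hw hn => h.2 w hw (hn.congr hA fun v hv => (hm v hv).symm)⟩

/-- The least neutral variable `z` stays the least one along the line in direction `z`: whatever is
neutral at `m + t z` is already neutral at `m`, because `z` is. -/
theorem IsDirection.add_single (hup : IsUpperSet A) {m : V → ℕ} {z : V}
    (h : IsDirection A x r m z) (t : ℕ) : IsDirection A x r (m + Pi.single z t) z := by
  obtain ⟨⟨hzx, hz⟩, hmin⟩ := h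
  refine ⟨⟨hzx, fun s i hi => ?_⟩, fun w hw hn => hmin w hw fun s i hi => ?_⟩
  · rw [add_assoc, ← Pi.single_add] at hi
    refine hup ?_ (hz _ _ hi)
    exact update_le_update_iff.2 ⟨le_rfl, fun j _ => by simp⟩
  · refine hz t i (hn s i (hup ?_ hi))
    refine update_le_update_iff.2 ⟨le_rfl, fun j _ => ?_⟩
    simp only [Pi.add_apply]; omega

theorem IsDirection.mono (hup : IsUpperSet A) (hA : ∀ m m', TruncEq N m m' → m ∈ A → m' ∈ A)
    {m m' : V → ℕ} {z : V} (h : IsDirection A x r m z) (hz : m z ≤ m' z)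
    (hm : ∀ v, v ≠ x → v ≠ z → min (m v) N = min (m' v) N) : IsDirection A x r m' z := by
  refine (h.add_single hup (m' z - m z)).congr hA fun v hv => ?_
  by_cases hvz : v = z
  · subst hvz
    simp [Nat.add_sub_cancel' hz]
  · simpa [hvz] using hm v hv hvz

/-- A neutral variable exists: for `m` the start of its ray in direction `x`, with `m x > 0`, take
a variable that keeps `m - x` outside `A`. -/
theorem exists_isDirection [Nontrivial V] (hup : IsUpperSet A)
    (hsat : ∀ u ∉ A, ∃ z, ∀ t, u + Pi.single z t ∉ A) (x : V) (r : V → ℕ) {m : V → ℕ}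
    (hm : m ∈ A) : ∃ z, IsDirection A x r m z := by
  classical
  obtain ⟨z, hzx, hz⟩ : ∃ z, z ≠ x ∧ Neutral A x m z := by
    have hex : ∃ i, Function.update m x i ∈ A := ⟨m x, by simpa using hm⟩
    have key : ∀ i, Nat.find hex ≤ i → Function.update m x i ∈ A := fun i hi =>
      hup (update_le_update_iff.2 ⟨hi, fun _ _ => le_rfl⟩) (Nat.find_spec hex)
    rcases hj : Nat.find hex with _ | j
    -- the slice is the whole line, so that every variable is neutral
    · obtain ⟨z, hz⟩ := exists_ne x
      exact ⟨z, hz, fun t i _ => key i (by omega)⟩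
    · obtain ⟨z, hz⟩ := hsat _ (Nat.find_min hex (m := j) (by omega))
      have hzx : z ≠ x := by
        rintro rfl
        refine hz 1 ?_
        have := key (j + 1) (by omega)
        convert this using 1
        ext v
        by_cases hv : v = z
        · subst hv; simp
        · simp [hv]
      refine ⟨z, hzx, fun t i hi => key i ?_⟩
      by_contra hlt
      refine hz t (hup ?_ hi)
      intro v
      by_cases hv : v = x
      · subst hv; simp; omega
      · simp [hv]
  have hne : ∃ n, ∃ z, r z = n ∧ z ≠ x ∧ Neutral A x m z := ⟨_, z, rfl, hzx, hz⟩
  obtain ⟨w, hw, hwx, hwn⟩ := Nat.find_spec hne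
  exact ⟨w, ⟨hwx, hwn⟩, fun y hy hyn => hw ▸ Nat.find_min' hne ⟨y, rfl, hy, hyn⟩⟩

/-- An upper set `A` that only depends on truncations at `N`, and none of whose non-elements is
driven into `A` by every variable, is partitioned by finitely many cells with at least two free
variables. The cell with corner `c` and free variables `Z c` consists of the `m ≥ c` that agree
with `c` outside `Z c`. -/
theorem exists_cells [Fintype V] [Nontrivial V] (hup : IsUpperSet A)
    (hA : ∀ m m', TruncEq N m m' → m ∈ A → m' ∈ A)
    (hsat : ∀ u ∉ A, ∃ z, ∀ t, u + Pi.single z t ∉ A) :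
    ∃ (ι : Finset (V → ℕ)) (Z : (V → ℕ) → Finset V),
      (∀ c ∈ ι, 2 ≤ (Z c).card) ∧ (∀ c ∈ ι, c ∈ A) ∧
      ∀ m ∈ A, ∃! c, c ∈ ι ∧ c ≤ m ∧ ∀ v ∉ Z c, m v = c v := by
  classical
  obtain ⟨x⟩ : Nonempty V := inferInstance
  let r : V → ℕ := fun v => Fintype.equivFin V v
  have hr : Function.Injective r := fun a b h => (Fintype.equivFin V).injective (Fin.ext h)
  have hdir : ∀ m : V → ℕ, ∃ z, m ∈ A → IsDirection A x r m z := fun m => by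
    by_cases hm : m ∈ A
    · obtain ⟨z, hz⟩ := exists_isDirection hup hsat x r hm
      exact ⟨z, fun _ => hz⟩
    · exact ⟨x, fun h => absurd h hm⟩
  choose f hf using hdir
  -- corners: points of the box that start both their ray in direction `x` and, within the part of
  -- their line in direction `f c` on which `f c` is the chosen direction, that part
  let ι : Set (V → ℕ) := {c | (∀ v, c v ≤ N) ∧ c ∈ A ∧
    (∀ i < c x, Function.update c x i ∉ A) ∧
    ∀ s < c (f c), ¬ IsDirection A x r (Function.update c (f c) s) (f c)}
  have hfin : ι.Finite := (Set.finite_Iic (fun _ : V => N)).subset fun c hc => hc.1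
  refine ⟨hfin.toFinset, fun c => insert x (insert (f c) (Finset.univ.filter fun v => c v = N)),
    ?_, ?_, ?_⟩
  · intro c hc
    have hc : c ∈ ι := by simpa using hc
    have hne : x ≠ f c := ((hf c hc.2.1).1.1).symm
    calc 2 = ({x, f c} : Finset V).card := (Finset.card_pair hne).symm
      _ ≤ _ := Finset.card_le_card (by intro v; simp; tauto)
  · intro c hc
    have hc : c ∈ ι := by simpa using hc
    exact hc.2.1
  intro m hm
  simp only [Set.Finite.mem_toFinset]
  have hd := hf m hm
  set z := f m with hz
  have hzx : z ≠ x := hd.1.1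
  -- a cell through `m` has the direction of `m`, the truncated entries of `m` off that direction
  -- and `x`, and the slice of `m` in direction `x`
  have key : ∀ c ∈ ι, c ≤ m →
      (∀ v ∉ insert x (insert (f c) (Finset.univ.filter fun v => c v = N)), m v = c v) → f c = z ∧ (∀ v, v ≠ x → v ≠ z → c v = min (m v) N) ∧
      (∀ i, Function.update c x i ∈ A ↔ Function.update m x i ∈ A) := by
    intro c hc hcm hcv
    have h1 : ∀ v, v ≠ x → v ≠ f c → c v = min (m v) N := fun v h1 h2 => by
      by_cases h3 : c v = N
      · have : c v ≤ m v := hcm v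
        omega
      · have := hcv v (by simp [h1, h2, h3])
        have := hc.1 v
        omega
    have hdc := hf c hc.2.1
    have h2 : IsDirection A x r m (f c) := hdc.mono hup hA (hcm _) fun v hv hv' => by
      rw [h1 v hv hv']; omega
    have h3 : f c = z := h2.unique hr hd
    refine ⟨h3, h3 ▸ h1, fun i => ⟨fun h => hup ?_ h, fun h => ?_⟩⟩
    · exact update_le_update_iff.2 ⟨le_rfl, fun j _ => hcm j⟩
    · refine hdc.1.2 (m (f c) - c (f c)) i (hA _ _ ?_ h)
      intro v
      by_cases hv : v = x
      · subst hv; simp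
      by_cases hv' : v = f c
      · have := hcm (f c)
        subst hv'
        simp [hv, Nat.add_sub_cancel' this]
      · simp [hv, hv', h1 v hv hv']
  have hexx : ∃ i, Function.update m x i ∈ A := ⟨m x, by simpa using hm⟩
  have hexz : ∃ s, IsDirection A x r (Function.update m z s) z := ⟨m z, by simpa using hd⟩
  have hxN : Nat.find hexx ≤ min (m x) N := by
    refine Nat.find_min' hexx (hA m _ (fun v => ?_) hm)
    by_cases hv : v = x
    · subst hv; simp
    · simp [hv]
  have hzN : Nat.find hexz ≤ min (m z) N := by
    refine Nat.find_min' hexz (hd.congr hA fun v _ => ?_)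
    by_cases hv : v = z
    · subst hv; simp
    · simp [hv]
  refine existsUnique_of_exists_of_unique ?_ ?_
  · let c : V → ℕ := fun v => if v = x then Nat.find hexx else
      if v = z then Nat.find hexz else min (m v) N
    have cx : c x = Nat.find hexx := by simp [c]
    have cz : c z = Nat.find hexz := by simp [c, hzx]
    have cv : ∀ v, v ≠ x → v ≠ z → c v = min (m v) N := fun v h h' => by simp [c, h, h']
    have hcm : ∀ v, c v ≤ min (m v) N := fun v => by
      by_cases hv : v = x
      · rw [hv, cx]; exact hxN
      by_cases hv' : v = z
      · rw [hv', cz]; exact hzN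
      · rw [cv v hv hv']
    have hcd : ∀ s, IsDirection A x r (Function.update c z s) z ↔
        IsDirection A x r (Function.update m z s) z := fun s => by
      have : ∀ v, v ≠ x →
          min (Function.update c z s v) N = min (Function.update m z s v) N := fun v hv => by
        by_cases hv' : v = z
        · subst hv'; simp
        · simp [hv', cv v hv hv']
      exact ⟨fun h => h.congr hA this, fun h => h.congr hA fun v hv => (this v hv).symm⟩
    have hdc : IsDirection A x r c z := by
      have := (hcd (c z)).2 (by rw [cz]; exact Nat.find_spec hexz)
      simpa using this
    have hcx : ∀ i, Function.update c x i ∈ A ↔ Function.update m x i ∈ A := fun i => by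
      refine ⟨fun h => hup ?_ h, fun h => ?_⟩
      · exact update_le_update_iff.2 ⟨le_rfl, fun j _ => (hcm j).trans (min_le_left _ _)⟩
      · refine hdc.1.2 (m z - c z) i (hA _ _ ?_ h)
        intro v
        by_cases hv : v = x
        · subst hv; simp
        by_cases hv' : v = z
        · have := hcm v
          subst hv'
          simp only [Function.update_of_ne hv, Pi.add_apply, Pi.single_eq_same]
          omega
        · simp [hv, hv', cv v hv hv']
    have hcA : c ∈ A := by
      have := (hcx (c x)).2 (by rw [cx]; exact Nat.find_spec hexx)
      simpa using this
    have hfc : f c = z := (hf c hcA).unique hr hdc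
    refine ⟨c, ⟨fun v => (hcm v).trans (min_le_right _ _), hcA, fun i hi h => ?_,
      fun s hs h => ?_⟩, fun v => (hcm v).trans (min_le_left _ _), fun v hv => ?_⟩
    · exact Nat.find_min hexx (cx ▸ hi) ((hcx i).1 h)
    · rw [hfc] at hs h
      exact Nat.find_min hexz (cz ▸ hs) ((hcd s).1 h)
    · simp only [hfc, Finset.mem_insert, Finset.mem_filter, Finset.mem_univ, true_and,
        not_or] at hv
      have := cv v hv.1 hv.2.1
      omega
  · rintro c c' ⟨hc, hcm, hcv⟩ ⟨hc', hcm', hcv'⟩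
    obtain ⟨h1, h2, h3⟩ := key c hc hcm hcv
    obtain ⟨h1', h2', h3'⟩ := key c' hc' hcm' hcv'
    have hx : c x = c' x := by
      refine le_antisymm (not_lt.1 fun h => ?_) (not_lt.1 fun h => ?_)
      · refine hc.2.2.1 _ h ((h3 _).2 ((h3' _).1 ?_)); simpa using hc'.2.1
      · refine hc'.2.2.1 _ h ((h3' _).2 ((h3 _).1 ?_)); simpa using hc.2.1
    have aux : ∀ c ∈ ι, ∀ c' ∈ ι, f c = z → f c' = z →
        (∀ v, v ≠ x → v ≠ z → c v = c' v) → c z ≤ c' z := by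
      intro c hc c' hc' h h' hcc
      refine not_lt.1 fun hlt => hc.2.2.2 (c' z) (h ▸ hlt) ?_
      have := hf c' hc'.2.1
      rw [h'] at this
      rw [h]
      refine this.congr hA fun v hv => ?_
      by_cases hv' : v = z
      · subst hv'; simp
      · simp [hv', hcc v hv hv']
    have hcc : ∀ v, v ≠ x → v ≠ z → c v = c' v := fun v hv hv' => by
      rw [h2 v hv hv', h2' v hv hv']
    ext v
    by_cases hv : v = x
    · rw [hv, hx]
    by_cases hv' : v = z
    · rw [hv']
      exact le_antisymm (aux c hc c' hc' h1 h1' hcc)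
        (aux c' hc' c hc h1' h1 fun v hv hv' => (hcc v hv hv').symm)
    · exact hcc v hv hv'

end Cells

universe u

/-! ### Powers of bipartite edge ideals and vertex covers -/

section Koenig

variable {V : Type u} [Fintype V] [DecidableEq V] {G : SimpleGraph V}

/-- The blow-up of `V` with `p v` copies of `v` has multiplicity vector `p`. -/
theorem sum_single_fst (p : V → ℕ) :
    ∑ x : (Σ v, Fin (p v)), Finsupp.single x.1 1 = Finsupp.equivFunOnFinite.symm p := by
  rw [Fintype.sum_sigma]
  ext v
  simp [Finsupp.finsetSum_apply, Finsupp.single_apply]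

/-- König's theorem with vertex capacities `d`: if each vertex cover has weight at least `k`, then
there are `k` edges, repetitions allowed, using each vertex `v` at most `d v` times. It is deduced
from Hall's theorem on the blow-up of `G` with `d v` copies of each vertex `v`. -/
theorem SimpleGraph.exists_edge_packing (hbip : G.IsBipartite) (d : V →₀ ℕ) (k : ℕ)
    (hd : ∀ C : Finset V, (∀ v w, G.Adj v w → v ∈ C ∨ w ∈ C) → k ≤ ∑ v ∈ C, d v) :
    ∃ (ι : Type u) (P : Finset ι) (a b : ι → V), k ≤ P.card ∧ (∀ i ∈ P, G.Adj (a i) (b i)) ∧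
      ∑ i ∈ P, (Finsupp.single (a i) 1 + Finsupp.single (b i) 1) ≤ d := by
  classical
  obtain ⟨s, t, hst⟩ := hbip.exists_isBipartiteWith
  -- the capacities on the two sides of the bipartition, whose blow-ups are to be matched
  let p : V → ℕ := fun v => if v ∈ s then d v else 0
  let q : V → ℕ := fun v => if v ∈ s then 0 else d v
  have hps : ∀ x : Σ v, Fin (p v), x.1 ∈ s := fun ⟨v, i⟩ => by
    by_contra h
    have := i.2
    simp [p, show v ∉ s from h] at this
  have hadj : ∀ v w, G.Adj v w → v ∈ s ∧ w ∉ s ∨ w ∈ s ∧ v ∉ s := fun v w h => by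
    rcases hst.mem_of_adj h with ⟨h1, h2⟩ | ⟨h1, h2⟩
    · exact Or.inl ⟨h1, fun h => Set.disjoint_left.1 hst.disjoint h h2⟩
    · exact Or.inr ⟨h2, fun h => Set.disjoint_left.1 hst.disjoint h h1⟩
  let n := Fintype.card (Σ v, Fin (p v))
  have hn : n = ∑ v, p v := by simp [n]
  have hkn : k ≤ n := by
    refine (hd {v | v ∈ s} fun v w h => ?_).trans_eq ?_
    · rcases hadj v w h with h | h <;> simp [h]
    · rw [hn, Finset.sum_filter]
  -- the deficiency `n - k` is made up for by as many dummies, adjacent to everything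
  let T : (Σ v, Fin (p v)) → Finset ((Σ v, Fin (q v)) ⊕ Fin (n - k)) := fun x =>
    Finset.disjSum {y | G.Adj x.1 y.1} Finset.univ
  obtain ⟨f, hf, hfT⟩ := (Finset.all_card_le_biUnion_card_iff_exists_injective T).1 (by
    intro S
    rcases S.eq_empty_or_nonempty with rfl | ⟨x₀, hx₀⟩
    · simp
    let B : Finset V := {v | v ∈ s}
    let U : Finset V := S.image Sigma.fst
    let W : Finset V := {b | ∃ a ∈ U, G.Adj a b}
    have hS : S.card ≤ ∑ v ∈ U, p v := by
      refine (Finset.card_le_card (t := U.sigma fun v => (Finset.univ : Finset (Fin (p v))))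
        fun x hx => ?_).trans_eq ?_
      · simp only [Finset.mem_sigma, Finset.mem_univ, and_true, U]
        exact Finset.mem_image_of_mem _ hx
      · simp [Finset.card_sigma]
    have hT : (∑ v ∈ W, q v) + (n - k) ≤ (S.biUnion T).card := by
      have : ((W.sigma fun v => (Finset.univ : Finset (Fin (q v)))).disjSum
          (Finset.univ : Finset (Fin (n - k)))).card = (∑ v ∈ W, q v) + (n - k) := by
        simp [Finset.card_sigma]
      rw [← this]
      refine Finset.card_le_card fun y hy => ?_
      rw [Finset.mem_biUnion]
      rcases y with y | y
      · simp only [Finset.inl_mem_disjSum, Finset.mem_sigma, Finset.mem_univ, and_true, W, U,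
          Finset.mem_filter, true_and, Finset.mem_image] at hy
        obtain ⟨a, ⟨x, hx, rfl⟩, hab⟩ := hy
        exact ⟨x, hx, by simpa [T] using hab⟩
      · exact ⟨x₀, hx₀, by simp [T]⟩
    -- the left vertices outside the projection `U` of `S`, with the neighbours `W` of `U`, form a
    -- cover, and its weight bound is Hall's condition for `S`
    have hC := hd ((B \ U) ∪ W) (fun v w h => by
      have aux : ∀ v w, v ∈ s → G.Adj v w → v ∈ ((B \ U) ∪ W : Finset V) ∨
          w ∈ ((B \ U) ∪ W : Finset V) := fun v w hv h => by
        by_cases hvU : v ∈ U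
        · exact Or.inr (Finset.mem_union_right _ (by simpa [W] using ⟨v, hvU, h⟩))
        · exact Or.inl (Finset.mem_union_left _ (by simp [B, hv, hvU]))
      rcases hadj v w h with h' | h'
      · exact aux v w h'.1 h
      · exact (aux w v h'.1 h.symm).symm)
    have hU : ∀ v ∈ U, v ∈ s := fun v hv => by
      obtain ⟨x, -, rfl⟩ := Finset.mem_image.1 hv
      exact hps x
    have hC' : ∑ v ∈ ((B \ U) ∪ W : Finset V), d v ≤
        ∑ v ∈ Finset.univ \ U, p v + ∑ v ∈ W, q v := by
      refine (Nat.le_add_right _ (∑ v ∈ (B \ U) ∩ W, d v)).trans ?_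
      rw [Finset.sum_union_inter]
      refine add_le_add ?_ ?_
      · refine (Finset.sum_congr rfl fun v hv => ?_ :
          _ = ∑ v ∈ ((B \ U)), p v).trans_le
          (Finset.sum_le_sum_of_subset (Finset.sdiff_subset_sdiff (Finset.subset_univ _) le_rfl))
        have : v ∈ s := by simp [B] at hv; exact hv.1
        simp [p, this]
      · refine (Finset.sum_congr rfl fun v hv => ?_).le
        simp only [W, Finset.mem_filter, Finset.mem_univ, true_and] at hv
        obtain ⟨a, ha, hav⟩ := hv
        have : v ∉ s := by
          rcases hadj a v hav with h | h
          · exact h.2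
          · exact absurd (hU a ha) h.2
        simp [q, this]
    have := Finset.sum_sdiff (f := p) (Finset.subset_univ U)
    omega)
  -- the left copies that are not matched to a dummy
  let P : Finset (Σ v, Fin (p v)) := {x | (f x).isLeft}
  have hPf : ∀ x ∈ P, ∃ y, f x = Sum.inl y := fun x hx => by
    simpa [P, Sum.isLeft_iff] using hx
  have : ∀ x, ∃ y : V, ∀ y', f x = Sum.inl y' → y = y'.1 := fun x => by
    rcases h : f x with y | y
    · exact ⟨y.1, fun y' h' => by simp_all⟩
    · exact ⟨x.1, fun y' h' => by simp at h'⟩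
  choose b hb using this
  refine ⟨_, P, Sigma.fst, b, ?_, fun x hx => ?_, ?_⟩
  · have h1 : Pᶜ.card ≤ n - k := by
      calc Pᶜ.card = (Pᶜ.image f).card := (Finset.card_image_of_injective _ hf).symm
        _ ≤ ((Finset.univ : Finset (Fin (n - k))).image Sum.inr).card := by
          refine Finset.card_le_card fun y hy => ?_
          obtain ⟨x, hx, rfl⟩ := Finset.mem_image.1 hy
          rcases h : f x with y | y
          · simp [P, h] at hx
          · simp
        _ ≤ _ := Finset.card_image_le.trans (by simp)
    have := Finset.card_add_card_compl P
    change _ = n at this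
    omega
  · obtain ⟨y, hy⟩ := hPf x hx
    rw [hb x y hy]
    have := hfT x
    rw [hy] at this
    simpa [T] using this
  · rw [Finset.sum_add_distrib]
    have h1 : ∑ x ∈ P, Finsupp.single x.1 1 ≤ Finsupp.equivFunOnFinite.symm p := by
      rw [← sum_single_fst]
      exact Finset.sum_le_sum_of_subset (Finset.subset_univ _)
    have h2 : ∑ x ∈ P, Finsupp.single (b x) 1 ≤ Finsupp.equivFunOnFinite.symm q := by
      rw [← sum_single_fst]
      have : ∑ x ∈ P, Finsupp.single (b x) 1 =
          ∑ z ∈ P.image f, Sum.elim (fun y => Finsupp.single y.1 1) (fun _ => 0) z := by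
        rw [Finset.sum_image hf.injOn]
        refine Finset.sum_congr rfl fun x hx => ?_
        obtain ⟨y, hy⟩ := hPf x hx
        rw [hb x y hy, hy, Sum.elim_inl]
      rw [this]
      refine (Finset.sum_le_sum_of_subset (Finset.subset_univ _)).trans ?_
      rw [Fintype.sum_sum_type]
      simp
    refine (add_le_add h1 h2).trans_eq ?_
    ext v
    by_cases hv : v ∈ s <;> simp [p, q, hv]

variable (K : Type*) [Field K]

/-- For bipartite graphs, the ordinary powers of the edge ideal agree with the symbolic ones:
`I(G) ^ k` is the intersection of the `k`-th powers of the primes of the vertex covers. -/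
theorem SimpleGraph.mem_edgeIdeal_pow_iff (hbip : G.IsBipartite) (k : ℕ) (f : MvPolynomial V K) :
    f ∈ G.edgeIdeal K ^ k ↔ ∀ d ∈ f.support, ∀ C : Finset V,
      (∀ v w, G.Adj v w → v ∈ C ∨ w ∈ C) → k ≤ ∑ v ∈ C, d v := by
  classical
  constructor
  · intro hf d hd C hC
    -- `J k` is the `k`-th power of the prime generated by the variables of `C`
    let J : ℕ → Ideal (MvPolynomial V K) := fun k =>
      Ideal.span ((fun e => monomial e (1 : K)) '' {e | k ≤ ∑ v ∈ C, e v})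
    have h1 : G.edgeIdeal K ≤ J 1 := by
      refine Ideal.span_le.2 ?_
      rintro _ ⟨v, w, h, rfl⟩
      refine Ideal.subset_span ⟨Finsupp.single v 1 + Finsupp.single w 1, ?_, ?_⟩
      · simp only [Set.mem_ofPred_eq, Finsupp.add_apply, Finset.sum_add_distrib,
          Finsupp.single_apply, Finset.sum_ite_eq]
        rcases hC v w h with h | h <;> simp [h]
      · simp [X, monomial_mul]
    have hJ : G.edgeIdeal K ^ k ≤ J k := by
      clear hf
      induction k with
      | zero =>
        refine le_of_le_of_eq le_top ((Ideal.eq_top_iff_one _).2 ?_).symm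
        exact Ideal.subset_span ⟨0, by simp, rfl⟩
      | succ k ih =>
        rw [pow_succ]
        refine (Ideal.mul_mono ih h1).trans ?_
        rw [Ideal.span_mul_span', Ideal.span_le]
        rintro _ ⟨_, ⟨e, he, rfl⟩, _, ⟨e', he', rfl⟩, rfl⟩
        refine Ideal.subset_span ⟨e + e', ?_, by simp [monomial_mul]⟩
        simp only [Set.mem_ofPred_eq, Finsupp.add_apply, Finset.sum_add_distrib] at *
        omega
    obtain ⟨e, he, hed⟩ := mem_ideal_span_monomial_image.1 (hJ hf) d hd
    exact le_trans he (Finset.sum_le_sum fun v _ => hed v)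
  · intro h
    rw [f.as_sum]
    refine Ideal.sum_mem _ fun d hd => ?_
    obtain ⟨ι, P, a, b, hP, hadj, hle⟩ := G.exists_edge_packing hbip d k (h d hd)
    obtain ⟨e, rfl⟩ := exists_add_of_le hle
    rw [← mul_one (coeff _ f), add_comm, ← monomial_mul]
    refine Ideal.mul_mem_left _ _ (Ideal.pow_le_pow_right hP ?_)
    rw [monomial_sum_one, ← Finset.prod_const]
    refine Ideal.prod_mem_prod fun i hi => Ideal.subset_span ⟨a i, b i, hadj i hi, ?_⟩
    simp [X, monomial_mul]

end Koenig

/-! ### From cells to Stanley decompositions -/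

section Decomposition

theorem free_span_singleton {R M : Type*} [Ring R] [IsDomain R] [AddCommGroup M] [Module R M]
    [Module.IsTorsionFree R M] {x : M} (hx : x ≠ 0) : Module.Free R (Submodule.span R {x}) :=
  Module.Free.of_equiv (LinearEquiv.toSpanNonzeroSingleton R M x hx)

variable {K V : Type*} [Field K] [Fintype V] [DecidableEq V]

instance isTorsionFree_supported_ideal (I : Ideal (MvPolynomial V K)) (Z : Set V) :
    Module.IsTorsionFree (supported K Z) I where
  isSMulRegular r hr f g h := by
    have h0 : (r : MvPolynomial V K) ≠ 0 := fun h0 => hr.ne_zero (Subtype.ext h0)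
    refine Subtype.ext (mul_left_cancel₀ h0 ?_)
    exact congrArg Subtype.val h

/-- A finite partition of the exponent vectors of a monomial ideal into cells with at least `n` free
variables each gives a Stanley decomposition of depth at least `n`. -/
theorem le_sdepth_of_cells (I : Ideal (MvPolynomial V K)) (A : Set (V → ℕ))
    (hI : ∀ f, f ∈ I ↔ ∀ d ∈ f.support, ⇑d ∈ A) (hup : IsUpperSet A)
    (n : ℕ∞) (ι : Finset (V → ℕ)) (Z : (V → ℕ) → Finset V)
    (hZ : ∀ c ∈ ι, n ≤ (Z c).card) (hι : ∀ c ∈ ι, c ∈ A)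
    (hcell : ∀ m ∈ A, ∃! c, c ∈ ι ∧ c ≤ m ∧ ∀ v ∉ Z c, m v = c v) :
    n ≤ I.sdepth := by
  classical
  have hmon : ∀ d : V →₀ ℕ, ⇑d ∈ A → monomial d (1 : K) ∈ I := fun d hd => by
    rw [hI]
    intro e he
    obtain rfl : e = d := by simpa using support_monomial_subset he
    exact hd
  let b : {d : V →₀ ℕ // ⇑d ∈ A} → I := fun d => ⟨monomial d.1 1, hmon d.1 d.2⟩
  have hb : LinearIndependent K b := by
    have h1 : LinearIndependent K (fun d : {d : V →₀ ℕ // ⇑d ∈ A} => basisMonomials V K d.1) :=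
      (basisMonomials V K).linearIndependent.comp _ Subtype.val_injective
    refine LinearIndependent.of_comp (I.subtype.restrictScalars K) ?_
    convert h1 using 1
    · ext1 d
      simp [b]
    · rfl
  have hspan : Submodule.span K (Set.range b) = ⊤ := by
    refine eq_top_iff.2 fun f _ => ?_
    have hf := (hI f.1).1 f.2
    have : f = ∑ d ∈ f.1.support.attach, coeff d.1 f.1 • b ⟨d.1, hf d.1 d.2⟩ := by
      refine Subtype.ext ?_
      rw [AddSubmonoidClass.coe_finsetSum]
      conv_lhs => rw [f.1.as_sum, ← Finset.sum_attach]
      refine Finset.sum_congr rfl fun d _ => ?_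
      change _ = coeff d.1 f.1 • monomial d.1 (1 : K)
      simp [smul_monomial]
    rw [this]
    exact Submodule.sum_mem _ fun d _ => Submodule.smul_mem _ _ (Submodule.subset_span ⟨_, rfl⟩)
  -- `b` is a basis of `I`, and the Stanley spaces are spanned by the parts of it in the cells
  let e := ι.equivFin.symm
  let u : Fin ι.card → {d : V →₀ ℕ // ⇑d ∈ A} := fun i =>
    ⟨Finsupp.equivFunOnFinite.symm (e i).1, by simpa using hι _ (e i).2⟩
  let cell : Fin ι.card → Set {d : V →₀ ℕ // ⇑d ∈ A} := fun i =>
    {d | (e i).1 ≤ ⇑d.1 ∧ ∀ v ∉ Z (e i).1, d.1 v = (e i).1 v}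
  have hspace : ∀ i, stanleySpace K (b (u i)) (Z (e i).1) = Submodule.span K (b '' cell i) := by
    intro i
    refine congrArg _ (Set.ext fun m => ⟨?_, ?_⟩)
    · rintro ⟨d, hd, rfl⟩
      refine ⟨⟨d + (u i).1, hup (fun v => Nat.le_add_left _ _) (u i).2⟩, ⟨?_, ?_⟩, ?_⟩
      · intro v; simp [u]
      · intro v hv
        have : d v = 0 := by
          by_contra h0
          exact hv (hd (Finsupp.mem_support_iff.2 h0))
        simp [u, this]
      · refine Subtype.ext ?_
        change _ = monomial d (1 : K) * monomial (u i).1 1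
        simp [b, monomial_mul]
    · rintro ⟨d, ⟨hd, hd'⟩, rfl⟩
      have hle : (u i).1 ≤ d.1 := fun v => by simpa [u] using hd v
      refine ⟨d.1 - (u i).1, fun v hv => ?_, Subtype.ext ?_⟩
      · by_contra hvZ
        have := hd' v hvZ
        simp [u, this] at hv
      · change _ = monomial (d.1 - (u i).1) (1 : K) * monomial (u i).1 1
        simp [b, monomial_mul, tsub_add_cancel_of_le hle]
  have hdisj : ∀ i j, i ≠ j → Disjoint (cell i) (cell j) := fun i j hij => by
    refine Set.disjoint_left.2 fun d hi hj => hij (e.injective (Subtype.ext ?_))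
    exact (hcell _ d.2).unique ⟨(e i).2, hi⟩ ⟨(e j).2, hj⟩
  have hcover : ∀ d, ∃ i, d ∈ cell i := fun d => by
    obtain ⟨c, ⟨hc, h⟩, -⟩ := hcell _ d.2
    exact ⟨e.symm ⟨c, hc⟩, by simpa [cell] using h⟩
  let D : StanleyDecomposition I.multidegreePart :=
    { len := ι.card
      gen := fun i => b (u i)
      vars := fun i => Z (e i).1
      gen_ne_zero := fun i => hb.ne_zero _
      homogeneous := fun i => ⟨fun v => ((u i).1 v : ℤ), fun d hd v => by
        obtain rfl : d = (u i).1 := by simpa using support_monomial_subset hd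
        rfl⟩
      free := fun i => free_span_singleton (hb.ne_zero (u i))
      isInternal := by
        refine DirectSum.isInternal_submodule_of_iSupIndep_of_iSup_eq_top (fun i => ?_) ?_
        · simp only [hspace, ← Submodule.span_iUnion, ← Set.image_iUnion]
          refine hb.disjoint_span_image ?_
          simp only [Set.disjoint_iUnion_right]
          exact fun j hj => hdisj i j hj.symm
        · simp only [hspace, ← Submodule.span_iUnion, ← Set.image_iUnion]
          rw [Set.iUnion_eq_univ_iff.2 hcover, Set.image_univ, hspan] }
  exact le_iSup_of_le D (le_iInf fun i => hZ _ (e i).2)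

end Decomposition

/-! ### Bipartite edge ideals -/

theorem theorem3p4 {K : Type*} [Field K] {V : Type*} [Fintype V] (G : SimpleGraph V)
    (hconn : G.Connected) (hbip : G.IsBipartite) (hedge : G.edgeSet.Nonempty)
    (k : ℕ) (hk : 1 ≤ k) (hkg : 2 * (k : ℕ∞) ≤ G.egirth + 2) :
    2 ≤ ((G.edgeIdeal K) ^ k).sdepth := by
  classical
  let IsCover : Finset V → Prop := fun C => ∀ v w, G.Adj v w → v ∈ C ∨ w ∈ C
  let A : Set (V → ℕ) := {d | ∀ C, IsCover C → k ≤ ∑ v ∈ C, d v}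
  obtain ⟨a, b, hab⟩ : ∃ a b, G.Adj a b := by
    obtain ⟨⟨a, b⟩, h⟩ := hedge
    exact ⟨a, b, h⟩
  have : Nontrivial V := ⟨a, b, hab.ne⟩
  have hup : IsUpperSet A := fun d d' h hd C hC =>
    (hd C hC).trans (Finset.sum_le_sum fun v _ => h v)
  have htrunc : ∀ m m' : V → ℕ, TruncEq k m m' → m ∈ A → m' ∈ A := by
    intro m m' h hm C hC
    by_cases hv : ∃ v ∈ C, k ≤ m' v
    · obtain ⟨v, hv, hkv⟩ := hv
      exact hkv.trans (Finset.single_le_sum (f := m') (fun _ _ => Nat.zero_le _) hv)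
    · push Not at hv
      refine (hm C hC).trans (Finset.sum_le_sum fun v hvC => ?_)
      have := hv v hvC
      have := h v
      omega
  have hsat : ∀ u ∉ A, ∃ z, ∀ t, u + Pi.single z t ∉ A := by
    intro u hu
    obtain ⟨C, hC, hCu⟩ : ∃ C, IsCover C ∧ ∑ v ∈ C, u v < k := by simpa [A] using hu
    obtain ⟨C', hC', hsub, z, hz⟩ : ∃ C', IsCover C' ∧ C' ⊆ C ∧ ∃ z, z ∉ C' := by
      by_cases h : ∃ z, z ∉ C
      · exact ⟨C, hC, subset_rfl, h⟩
      · -- the cover is all of `V`: pass to one side of a bipartition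
        obtain ⟨s, t, hst⟩ := hbip.exists_isBipartiteWith
        push Not at h
        refine ⟨Finset.univ.filter (· ∈ s), fun v w hvw => ?_, fun v _ => h v, ?_⟩
        · rcases hst.mem_of_adj hvw with h | h <;> simp [h]
        · rcases hst.mem_of_adj hab with ⟨-, h⟩ | ⟨h, -⟩
          · exact ⟨b, by simpa using fun h' => Set.disjoint_left.1 hst.disjoint h' h⟩
          · exact ⟨a, by simpa using fun h' => Set.disjoint_left.1 hst.disjoint h' h⟩
    refine ⟨z, fun t h => absurd (h C' hC') (not_le.2 ?_)⟩
    refine lt_of_eq_of_lt (Finset.sum_congr rfl fun v hv => ?_)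
      ((Finset.sum_le_sum_of_subset hsub).trans_lt hCu)
    have : v ≠ z := fun h => hz (h ▸ hv)
    simp [this]
  obtain ⟨ι, Z, hZ, hι, hcell⟩ := exists_cells hup htrunc hsat
  exact le_sdepth_of_cells _ A (G.mem_edgeIdeal_pow_iff K hbip k) hup 2 ι Z
    (fun c hc => by exact_mod_cast hZ c hc) hι hcell
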